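/- For $n\ge 0$ let $CRY_n$ be the Chan--Robbins--Yuen polytope of order $n$: the convex hull in $\mathbb{R}^{n\times n}$ of the $n\times n$ permutation matrices $\pi$ with $\pi_{i,j}=0$ whenever $j\ge i+2$. (For $n=0$ this is a single point, the empty matrix.) The faces of $CRY_n$ include the empty face, which has dimension $-1$, and $CRY_n$ itself. Define $$F(t,x) := \frac{1}{x-xt} + \sum_{n=0}^{\infty} t^n x^{-n} \prod_{i=1}^{n} \frac{(1+x)^i-1}{1+\bigl((1+x)^i-1-x\bigr)\,t\,x^{-1}},$$ a formal power series in $t$ whose coefficients are formal Laurent series in $x$; the infinite sum is well defined because its $n$-th term is divisible by $t^n$. Then for all integers $n\ge 0$ and $d$, the polytope $CRY_n$ has finitely many $d$-dimensional faces, and their number is the coefficient $[t^n x^d]F(t,x)$. -/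

import Mathlib

namespace CRY

/-- The Chan-Robbins-Yuen polytope of order `n`: the convex hull, in the space of real `n × n`
matrices, of the permutation matrices whose `(i, j)` entry vanishes whenever `j ≥ i + 2`.
(The condition depends only on `j - i`, so it does not matter that `Fin n` counts from `0`.) -/
def polytope (n : ℕ) : Set (Matrix (Fin n) (Fin n) ℝ) :=
  convexHull ℝ {M | (∃ σ : Equiv.Perm (Fin n), M = σ.permMatrix ℝ) ∧
    ∀ i j : Fin n, (i : ℕ) + 2 ≤ (j : ℕ) → M i j = 0}

open Classical in
/-- The dimension of a set in a real vector space: the dimension of its affine hull, with the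
convention that the empty set has dimension `-1`. -/
noncomputable def dimension {E : Type*} [AddCommGroup E] [Module ℝ E] (A : Set E) : ℤ :=
  if A = ∅ then -1 else (Module.finrank ℝ (vectorSpan ℝ A) : ℤ)

/-- The `d`-dimensional faces of a polytope `P`. A face is a subset of `P` which is empty or is the
locus where some linear functional attains its maximum over `P`; thus the empty face and `P` itself
are faces. -/
def facesOfDim {E : Type*} [AddCommGroup E] [Module ℝ E] [TopologicalSpace E]
    (P : Set E) (d : ℤ) : Set (Set E) :=
  {A | IsExposed ℝ P A ∧ dimension A = d}

/-- The variable `x`, in the field `ℚ((x))` of formal Laurent series. -/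
noncomputable def x : LaurentSeries ℚ := HahnSeries.single (1 : ℤ) (1 : ℚ)

/-- The variable `t`, in the ring `ℚ((x))[[t]]` of formal power series over `ℚ((x))`. -/
noncomputable def t : PowerSeries (LaurentSeries ℚ) := PowerSeries.X

/-- An element of `ℚ((x))`, viewed as a constant power series in `t`. -/
noncomputable def const (a : LaurentSeries ℚ) : PowerSeries (LaurentSeries ℚ) := PowerSeries.C a

/-- The denominator `1 + ((1 + x) ^ i - 1 - x) t x⁻¹`. -/
noncomputable def denom (i : ℕ) : PowerSeries (LaurentSeries ℚ) :=
  1 + const ((1 + x) ^ i - 1 - x) * t * const x⁻¹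

/-- The summand
`t ^ n x ^ (-n) ∏_{i = 1}^{n} ((1 + x) ^ i - 1) / (1 + ((1 + x) ^ i - 1 - x) t x⁻¹)`. -/
noncomputable def summand (n : ℕ) : PowerSeries (LaurentSeries ℚ) :=
  t ^ n * const (x ^ (-(n : ℤ))) *
    ∏ i ∈ Finset.Icc 1 n, const ((1 + x) ^ i - 1) * (denom i)⁻¹

/-- The inverses in `summand` are genuine. -/
theorem denom_mul_inv (i : ℕ) : denom i * (denom i)⁻¹ = 1 := by
  apply PowerSeries.mul_inv_cancel
  simp [denom, t, const]

/-- The inverse of `x - x t` is genuine. -/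
theorem x_sub_mul_inv : (const x - const x * t) * (const x - const x * t)⁻¹ = 1 := by
  apply PowerSeries.mul_inv_cancel
  simp [t, const, x]

/-- The `n`-th summand is divisible by `t ^ n`, so only the summands with `n ≤ N` contribute to
the coefficient of `t ^ N`. -/
theorem coeff_summand_eq_zero {N n : ℕ} (h : N < n) :
    PowerSeries.coeff N (summand n) = 0 := by
  have hdvd : (PowerSeries.X : PowerSeries (LaurentSeries ℚ)) ^ n ∣ summand n := by
    unfold summand t
    rw [mul_assoc]
    exact Dvd.intro _ rfl
  exact PowerSeries.X_pow_dvd_iff.mp hdvd N h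

/-- The formal infinite sum `∑_{n ≥ 0} summand n`: by `coeff_summand_eq_zero`, the coefficient of
`t ^ N` is the sum of the coefficients of `t ^ N` in all the summands. -/
noncomputable def summandSeries : PowerSeries (LaurentSeries ℚ) :=
  PowerSeries.mk fun N => ∑ n ∈ Finset.range (N + 1), PowerSeries.coeff N (summand n)

/-- The generating function
`F(t, x) = 1 / (x - x t) + ∑_{n ≥ 0} t ^ n x ^ (-n)
  ∏_{i = 1}^{n} ((1 + x) ^ i - 1) / (1 + ((1 + x) ^ i - 1 - x) t x⁻¹)`. -/
noncomputable def F : PowerSeries (LaurentSeries ℚ) :=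
  (const x - const x * t)⁻¹ + summandSeries

end CRY

/-! By Birkhoff's theorem `polytope n` consists of the doubly stochastic matrices that vanish above
the superdiagonal (`mem_polytope_iff`). Read the entry `(i, j)` with `j ≤ i` as the flow on an edge
from `j` to `i + 1` in a graph on `0, …, n`. Comparing row `i` with column `i + 1` gives
conservation at `i + 1`, so the points of the polytope are the unit flows from `0` to `n`; the
superdiagonal entry of row `i` is the flow passing over the vertex `i + 1` (`IsHessenberg.cut`).

A nonempty face is therefore given by the set of edges it may use. The sets that occur are those in
which the sink is entered and every other vertex is left exactly when it is entered or is the source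
(`exists_lowerSupport_eq`, `exists_eq_face`). The face has one dimension per edge, minus one
conservation law per entered vertex (`finrank_ker_conservation`).

To sum `y ^ faceDim H`, expand the condition "entered iff left" at each vertex by
inclusion-exclusion over sets `S` of vertices. For fixed `S` the rows become independent, and each
contributes a weight depending only on how many elements of `S` precede it (`indicator_isValid`).
The sum over `S` is then a walk on the natural numbers that goes up from `k` with weight `upWeight y
k` and stays with weight `1 - upWeight y k` (`sum_validSets_succ`). Its generating function
satisfies a first-order recursion in `k`, and unrolling it yields the summands of `F`
(`one_add_stateSeries`). The term `1 / (x - x t)` counts the empty face. -/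

namespace CRY

open Finset

/-! ### Signed subset sums as iterates of a transfer operator -/

/-- One step of the transfer operator with weights `a k` (move up) and `1 - a k` (stay). -/
def transfer {R : Type*} [CommRing R] (a g : ℕ → R) : ℕ → R :=
  fun k => a k * g (k + 1) + (1 - a k) * g k

/-- Scan `1, …, m` in order, with the number of elements of `S` met so far as the state. Membership
of `0` fixes the starting state, `1` or `0`, and the sign. Induction removes the last element of the
scan and absorbs it into `g`. -/
theorem sum_powerset_range_transfer {R : Type*} [CommRing R] (a : ℕ → R) (m : ℕ) (g : ℕ → R) :
    ∑ S ∈ (range (m + 1)).powerset, (if 0 ∈ S then 1 else -1) *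
      (∏ i ∈ range m, if i + 1 ∈ S then a #(S ∩ range (i + 1)) else 1 - a #(S ∩ range (i + 1))) *
        g #S = (transfer a)^[m] g 1 - (transfer a)^[m] g 0 := by
  induction m generalizing g with
  | zero =>
    rw [show range (0 + 1) = insert 0 ∅ by rfl, sum_powerset_insert (by simp)]
    simp
    ring
  | succ m ih =>
    rw [Function.iterate_succ_apply, ← ih, range_add_one (n := m + 1),
      sum_powerset_insert (by simp), ← sum_add_distrib]
    refine sum_congr rfl fun S hS => ?_
    have hS : S ⊆ range (m + 1) := mem_powerset.1 hS
    have hm : m + 1 ∉ S := fun h => by simpa using hS h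
    have hI : S ∩ range (m + 1) = S := inter_eq_left.2 hS
    rw [prod_range_succ, prod_range_succ, if_neg hm, hI,
      if_pos (mem_insert_self _ _), card_insert_of_notMem hm,
      insert_inter_of_notMem (by simp), hI]
    have : ∏ i ∈ range m, (if i + 1 ∈ insert (m + 1) S
        then a #(insert (m + 1) S ∩ range (i + 1)) else 1 - a #(insert (m + 1) S ∩ range (i + 1)))
        = ∏ i ∈ range m, (if i + 1 ∈ S
        then a #(S ∩ range (i + 1)) else 1 - a #(S ∩ range (i + 1))) := by
      refine prod_congr rfl fun i hi => ?_
      have hi : i < m := by simpa using hi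
      rw [insert_inter_of_notMem (by simp; omega)]
      simp [show i ≠ m by omega]
    rw [this]
    simp only [transfer, mem_insert, Nat.zero_ne_add_one, false_or]
    ring

/-! ### Valid supports and their weighted count -/

variable {n : ℕ}

/-- Vertex `v` of the flow graph is visited: it is the source, or row `v - 1` is nonempty. -/
def Alive (H : Fin n → Finset ℕ) (v : ℕ) : Prop :=
  ∀ i : Fin n, (i : ℕ) + 1 = v → (H i).Nonempty

/-- `H` lists the rows of the support, on and below the diagonal, of some point of the polytope:
equivalently it is a union of paths from the source `0` to the sink `n`, where `j ∈ H i` stands for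
the edge from `j` to `i + 1`. -/
structure IsValid (H : Fin n → Finset ℕ) : Prop where
  sub : ∀ i, H i ⊆ range (i + 1)
  alive_iff : ∀ v < n, Alive H v ↔ ∃ i, v ∈ H i
  alive_last : Alive H n

/-- The dimension of the face belonging to `H`. -/
def faceDim (H : Fin n → Finset ℕ) : ℕ := ∑ i, (#(H i) - 1)

open Classical in
/-- The supports of the nonempty faces. -/
noncomputable def validSets (n : ℕ) : Finset (Fin n → Finset ℕ) :=
  (Fintype.piFinset fun i : Fin n => (range (i + 1)).powerset).filter IsValid

theorem mem_validSets {H : Fin n → Finset ℕ} : H ∈ validSets n ↔ IsValid H := by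
  simp only [validSets, mem_filter, Fintype.mem_piFinset, mem_powerset, and_iff_right_iff_imp]
  exact fun h => h.sub

/-- The weight of moving up from state `k`. -/
def upWeight {K : Type*} [Field K] (y : K) (k : ℕ) : K := y⁻¹ * ((1 + y) ^ k - 1)

theorem sum_powerset_nonempty {K : Type*} [Field K] {y : K} (hy : y ≠ 0) (T : Finset ℕ) :
    ∑ I ∈ T.powerset, (y ^ (#I - 1) * if I.Nonempty then 1 else 0) = upWeight y #T := by
  have h1 : ∑ I ∈ T.powerset, y ^ #I = (1 + y) ^ #T := by
    rw [← prod_const, prod_one_add]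
    simp
  have h2 : ∀ I : Finset ℕ, (y ^ (#I - 1) * if I.Nonempty then (1 : K) else 0) =
      y⁻¹ * (y ^ #I - if I = ∅ then 1 else 0) := by
    intro I
    rcases I.eq_empty_or_nonempty with rfl | h
    · simp
    · obtain ⟨k, hk⟩ := Nat.exists_eq_succ_of_ne_zero h.card_pos.ne'
      simp only [hk, h, if_true, h.ne_empty, if_false]
      simp [pow_succ]
      field_simp
  simp_rw [h2, ← mul_sum, sum_sub_distrib, h1]
  simp [upWeight]

/-- The empty set contributes `1`, since the truncated exponent is `0`, and each nonempty set occurs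
with its sign reversed. -/
theorem sum_powerset_signed {K : Type*} [Field K] {y : K} (hy : y ≠ 0) (T : Finset ℕ) :
    ∑ I ∈ T.powerset, (y ^ (#I - 1) * (1 - 2 * if I.Nonempty then 1 else 0)) =
      1 - upWeight y #T := by
  have h : ∀ I : Finset ℕ, (y ^ (#I - 1) * (1 - 2 * if I.Nonempty then (1 : K) else 0)) =
      (if I = ∅ then 1 else 0) - (y ^ (#I - 1) * if I.Nonempty then 1 else 0) := by
    intro I
    rcases I.eq_empty_or_nonempty with rfl | h
    · simp
    · simp [h, h.ne_empty]; ring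
  simp_rw [h, sum_sub_distrib, sum_powerset_nonempty hy]
  simp

open Classical in
-- With indicators `a` and `b`, the indicator of `a ↔ b` is `a + (1 - 2 * a) * (1 - b)`. Multiply
-- out over the vertices and let `S` be the set where the first term is taken. The factors `1 - b`
-- off `S` say that no edge leaves a vertex outside `S`, and what remains is a product over rows.
theorem indicator_isValid {K : Type*} [Field K] {m : ℕ} {H : Fin (m + 1) → Finset ℕ}
    (hH : ∀ i, H i ⊆ range (i + 1)) :
    (if IsValid H then (1 : K) else 0) = ∑ S ∈ (range (m + 1)).powerset,
      if ∀ i, H i ⊆ S then (if 0 ∈ S then 1 else -1) * ∏ i : Fin (m + 1),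
        (if (i : ℕ) + 1 ∈ S ∨ (i : ℕ) = m then (if (H i).Nonempty then 1 else 0)
          else (1 - 2 * if (H i).Nonempty then 1 else 0)) else 0 := by
  have hval : (if IsValid H then (1 : K) else 0) = (if Alive H (m + 1) then 1 else 0) *
      ∏ v ∈ range (m + 1), ((if Alive H v then 1 else 0) +
        (1 - 2 * if Alive H v then 1 else 0) * if ∃ i, v ∈ H i then 0 else 1) := by
    have h1 : ∀ v, ((if Alive H v then (1 : K) else 0) +
        (1 - 2 * if Alive H v then 1 else 0) * if ∃ i, v ∈ H i then 0 else 1) =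
        if (Alive H v ↔ ∃ i, v ∈ H i) then 1 else 0 := by
      intro v
      by_cases h1 : Alive H v <;> by_cases h2 : ∃ i, v ∈ H i <;> simp only [h1, h2] <;> norm_num
    simp_rw [h1]
    rw [prod_ite_zero]
    simp only [prod_const_one]
    by_cases hv : IsValid H
    · rw [if_pos hv, if_pos hv.alive_last, if_pos fun v hv' => hv.alive_iff v (mem_range.1 hv')]
      simp
    · rw [if_neg hv]
      by_cases h2 : Alive H (m + 1)
      · rw [if_neg fun h3 : ∀ v ∈ range (m + 1), _ =>
          hv ⟨hH, fun v hv' => h3 v (mem_range.2 hv'), h2⟩]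
        simp
      · simp [h2]
  rw [hval, prod_add, mul_sum]
  refine sum_congr rfl fun S hS => ?_
  rw [prod_mul_distrib]
  have hcol : (∏ v ∈ range (m + 1) \ S, if ∃ i, v ∈ H i then (0 : K) else 1) =
      if ∀ i, H i ⊆ S then 1 else 0 := by
    by_cases h : ∀ i, H i ⊆ S
    · rw [if_pos h]
      refine prod_eq_one fun v hv => if_neg ?_
      rintro ⟨i, hi⟩
      exact (mem_sdiff.1 hv).2 (h i hi)
    · rw [if_neg h]
      push Not at h
      obtain ⟨i, hi⟩ := h
      obtain ⟨v, hv, hvS⟩ := not_subset.1 hi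
      refine prod_eq_zero (i := v) (mem_sdiff.2 ⟨?_, hvS⟩) (if_pos ⟨i, hv⟩)
      have := mem_range.1 (hH i hv)
      exact mem_range.2 (by omega)
  rw [hcol]
  by_cases h : ∀ i, H i ⊆ S
  swap
  · simp [h]
  rw [if_pos h, if_pos h, mul_one]
  have hS : S ⊆ range (m + 1) := mem_powerset.1 hS
  have hcomb : (∏ v ∈ S, if Alive H v then (1 : K) else 0) *
      ∏ v ∈ range (m + 1) \ S, (1 - 2 * if Alive H v then (1 : K) else 0) =
      ∏ v ∈ range (m + 1), if v ∈ S then (if Alive H v then 1 else 0)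
        else (1 - 2 * if Alive H v then 1 else 0) := by
    rw [prod_ite _ _ (p := fun v => v ∈ S), filter_mem_eq_inter, filter_notMem_eq_sdiff,
      inter_eq_right.2 hS]
  have halive : ∀ i : Fin (m + 1), Alive H (i + 1) ↔ (H i).Nonempty := fun i =>
    ⟨fun h => h i rfl, fun h j hj => by rwa [show j = i from Fin.ext (by omega)]⟩
  -- The source is always alive, so its factor is `1` if `0 ∈ S` and `1 - 2 = -1` otherwise.
  have h0 : Alive H 0 := fun i hi => by omega
  have hlast := halive (Fin.last m)
  simp only [Fin.val_last] at hlast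
  rw [hcomb, prod_range_succ', Fin.prod_univ_castSucc, Finset.prod_range]
  simp only [h0, hlast, Fin.val_last, or_true, if_true]
  have : ∀ i : Fin m, Alive H (i + 1) ↔ (H i.castSucc).Nonempty := fun i => halive i.castSucc
  simp only [this, Fin.val_castSucc, (Fin.is_lt _).ne, or_false]
  rw [show (1 : K) - 2 * 1 = -1 by norm_num]
  ring

theorem sum_validSets_succ {K : Type*} [Field K] {y : K} (hy : y ≠ 0) (m : ℕ) :
    ∑ H ∈ validSets (m + 1), y ^ faceDim H = (transfer (upWeight y))^[m] (upWeight y) 1 := by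
  classical
  -- Since `upWeight y 0 = 0`, a walk starting at `0` never moves and ends with weight `0`; only the
  -- start at `1` survives.
  have hzero : ∀ k, (transfer (upWeight y))^[k] (upWeight y) 0 = 0 := by
    intro k
    induction k with
    | zero => simp [upWeight]
    | succ k ih =>
      rw [Function.iterate_succ_apply']
      simp [transfer, ih, upWeight]
  have key := sum_powerset_range_transfer (upWeight y) m (upWeight y)
  rw [hzero, sub_zero] at key
  rw [← key, validSets, sum_filter]
  have h1 : ∀ H ∈ Fintype.piFinset fun i : Fin (m + 1) => (range (i + 1)).powerset,
      (if IsValid H then y ^ faceDim H else 0) = ∑ S ∈ (range (m + 1)).powerset,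
        if ∀ i, H i ⊆ S then (if 0 ∈ S then 1 else -1) * ∏ i : Fin (m + 1),
        (y ^ (#(H i) - 1) * if (i : ℕ) + 1 ∈ S ∨ (i : ℕ) = m then
          (if (H i).Nonempty then 1 else 0)
          else (1 - 2 * if (H i).Nonempty then 1 else 0)) else 0 := by
    intro H hH
    have hH : ∀ i, H i ⊆ range (i + 1) := by simpa using hH
    rw [← mul_boole, indicator_isValid hH, mul_sum]
    refine sum_congr rfl fun S _ => ?_
    rw [mul_ite, mul_zero, prod_mul_distrib, faceDim, prod_pow_eq_pow_sum]
    congr 1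
    ring
  rw [sum_congr rfl h1, sum_comm]
  refine sum_congr rfl fun S hS => ?_
  have hS : S ⊆ range (m + 1) := mem_powerset.1 hS
  rw [← sum_filter]
  -- For fixed `S` the rows range independently over subsets of `S ∩ range (i + 1)`, so the sum of
  -- products factors.
  have h2 : (Fintype.piFinset fun i : Fin (m + 1) => (range (i + 1)).powerset).filter
      (fun H => ∀ i, H i ⊆ S) =
      Fintype.piFinset fun i : Fin (m + 1) => (S ∩ range (i + 1)).powerset := by
    ext H
    simp only [mem_filter, Fintype.mem_piFinset, mem_powerset, subset_inter_iff]
    exact ⟨fun h i => ⟨h.2 i, h.1 i⟩, fun h => ⟨fun i => (h i).2, fun i => (h i).1⟩⟩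
  rw [h2, ← mul_sum, ← prod_univ_sum (fun i : Fin (m + 1) => (S ∩ range (i + 1)).powerset)
    (fun i I => y ^ (#I - 1) * if (i : ℕ) + 1 ∈ S ∨ (i : ℕ) = m then
          (if I.Nonempty then 1 else 0) else (1 - 2 * if I.Nonempty then 1 else 0)), mul_assoc]
  congr 1
  rw [Fin.prod_univ_castSucc, Finset.prod_range]
  congr 1
  · refine prod_congr rfl fun i _ => ?_
    simp only [Fin.val_castSucc, i.is_lt.ne, or_false]
    split_ifs
    · exact sum_powerset_nonempty hy _
    · exact sum_powerset_signed hy _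
  · simp only [Fin.val_last, or_true, if_true]
    rw [sum_powerset_nonempty hy, inter_eq_left.2 hS]

theorem sum_validSets_zero {K : Type*} [Field K] (y : K) :
    ∑ H ∈ validSets 0, y ^ faceDim H = 1 := by
  have : validSets 0 = {Fin.elim0} := by
    ext H
    simp only [mem_validSets, mem_singleton, Subsingleton.elim H Fin.elim0, iff_true]
    exact ⟨fun i => i.elim0, fun v hv => by omega, fun i => i.elim0⟩
  simp [this, faceDim]

/-! ### The generating function -/

theorem x_ne_zero : x ≠ 0 := by simp [x]

/-- `∑ r, (transfer ^ r a) k * t ^ r` -/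
noncomputable def stateSeries (k : ℕ) : PowerSeries (LaurentSeries ℚ) :=
  PowerSeries.mk fun r => (transfer (upWeight x))^[r] (upWeight x) k

/-- First-step analysis of the walk: `denom k` is `1 - (1 - upWeight x k) * t`, which accounts for
the steps that stay at `k`. -/
theorem denom_mul_stateSeries (k : ℕ) :
    denom k * stateSeries k = const (upWeight x k) * (1 + t * stateSeries (k + 1)) := by
  have hd : denom k = 1 - const (1 - upWeight x k) * t := by
    have : const (1 - upWeight x k) = - (const ((1 + x) ^ k - 1 - x) * const x⁻¹) := by
      rw [const, const, const, ← map_mul, ← map_neg]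
      congr 1
      have := x_ne_zero
      simp only [upWeight]
      field_simp
      ring
    rw [denom, this]
    ring
  rw [hd]
  ext1 r
  cases r with
  | zero => simp [stateSeries, const, t]
  | succ r =>
    rw [sub_mul, one_mul, mul_add, mul_one, mul_assoc, const, const, t, map_sub, map_add]
    simp only [PowerSeries.coeff_C_mul,
      PowerSeries.coeff_succ_X_mul, PowerSeries.coeff_C, stateSeries, PowerSeries.coeff_mk,
      Function.iterate_succ_apply']
    simp [transfer]

theorem summand_succ (k : ℕ) :
    summand (k + 1) = summand k * (t * const (upWeight x (k + 1)) * (denom (k + 1))⁻¹) := by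
  have h : const (x ^ (-((k + 1 : ℕ) : ℤ))) * const ((1 + x) ^ (k + 1) - 1) =
      const (x ^ (-(k : ℤ))) * const (upWeight x (k + 1)) := by
    rw [const, const, const, const, ← map_mul, ← map_mul]
    congr 1
    have := x_ne_zero
    rw [upWeight, ← mul_assoc]
    congr 1
    rw [Nat.cast_succ, neg_add, zpow_add₀ this, zpow_neg_one]
  rw [summand, summand, prod_Icc_succ_top (by omega)]
  calc _ = t ^ k * t * (const (x ^ (-((k + 1 : ℕ) : ℤ))) * const ((1 + x) ^ (k + 1) - 1)) *
      (∏ i ∈ Icc 1 k, const ((1 + x) ^ i - 1) * (denom i)⁻¹) * (denom (k + 1))⁻¹ := by ring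
    _ = _ := by rw [h]; ring

/-- Solving `denom_mul_stateSeries` for `stateSeries (k + 1)` turns the remainder into the next
summand plus a new remainder. -/
theorem one_add_stateSeries (k : ℕ) :
    1 + t * stateSeries 1 =
      ∑ j ∈ range (k + 1), summand j + summand k * (t * stateSeries (k + 1)) := by
  induction k with
  | zero => simp [summand, const]
  | succ k ih =>
    rw [ih, sum_range_succ _ (k + 1), add_assoc, add_assoc]
    congr 1
    have : stateSeries (k + 1) = (denom (k + 1))⁻¹ *
        (const (upWeight x (k + 1)) * (1 + t * stateSeries (k + 1 + 1))) := by
      rw [← denom_mul_stateSeries, ← mul_assoc, mul_comm _ (denom _), denom_mul_inv, one_mul]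
    rw [summand_succ, this]
    ring_nf

theorem coeff_summandSeries (n : ℕ) :
    PowerSeries.coeff n summandSeries = ∑ H ∈ validSets n, x ^ faceDim H := by
  have h : PowerSeries.coeff n (1 + t * stateSeries 1) = PowerSeries.coeff n summandSeries := by
    rw [one_add_stateSeries n, map_add, map_sum, summandSeries, PowerSeries.coeff_mk,
      summand, t]
    -- The remainder is divisible by `t ^ (n + 1)`.
    rw [show ∀ a b d : PowerSeries (LaurentSeries ℚ), PowerSeries.X ^ n * a * b *
      (PowerSeries.X * d) = PowerSeries.X ^ (n + 1) * (a * b * d) by intros; ring]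
    rw [PowerSeries.coeff_X_pow_mul', if_neg (by omega), add_zero]
  rw [← h]
  cases n with
  | zero => simp [sum_validSets_zero, t]
  | succ m =>
    rw [sum_validSets_succ x_ne_zero, t]
    simp [stateSeries, PowerSeries.coeff_one, PowerSeries.coeff_succ_X_mul]

theorem coeff_F (n : ℕ) (d : ℤ) : (PowerSeries.coeff n F).coeff d =
    (if d = -1 then 1 else 0) + #{H ∈ validSets n | (faceDim H : ℤ) = d} := by
  have h1 : (const x - const x * t)⁻¹ = const x⁻¹ * PowerSeries.mk 1 := by
    rw [PowerSeries.inv_eq_iff_mul_eq_one (by simp [t, const, x])]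
    have : const x * const x⁻¹ = 1 := by
      rw [const, const, ← map_mul, mul_inv_cancel₀ x_ne_zero, map_one]
    calc _ = const x * const x⁻¹ * (PowerSeries.mk 1 * (1 - PowerSeries.X)) := by rw [t]; ring
      _ = 1 := by rw [this, PowerSeries.mk_one_mul_one_sub_eq_one, one_mul]
  rw [F, map_add, h1, coeff_summandSeries]
  have h2 : PowerSeries.coeff n (const x⁻¹ * PowerSeries.mk 1) = HahnSeries.single (-1) 1 := by
    simp [const, x, HahnSeries.inv_single]
  have h3 : ∀ k : ℕ, x ^ k = HahnSeries.single (k : ℤ) (1 : ℚ) := by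
    intro k
    simp [x, HahnSeries.single_pow]
  rw [h2, HahnSeries.coeff_add, HahnSeries.coeff_single]
  simp only [h3, HahnSeries.coeff_sum, HahnSeries.coeff_single, eq_comm (a := d)]
  simp
-- Points of the polytope as flows
/-- `M` vanishes above the superdiagonal and has all row and column sums equal to `c`. -/
structure IsHessenberg (c : ℝ) (M : Matrix (Fin n) (Fin n) ℝ) : Prop where
  zero : ∀ i j : Fin n, (i : ℕ) + 2 ≤ j → M i j = 0
  row : ∀ i, ∑ j, M i j = c
  col : ∀ j, ∑ i, M i j = c

theorem mem_polytope_iff {M : Matrix (Fin n) (Fin n) ℝ} :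
    M ∈ polytope n ↔ IsHessenberg 1 M ∧ ∀ i j, 0 ≤ M i j := by
  constructor
  · have hconv : Convex ℝ {M : Matrix (Fin n) (Fin n) ℝ | ∀ i j : Fin n,
        (i : ℕ) + 2 ≤ j → M i j = 0} := by
      intro A hA B hB a b _ _ _ i j hij
      simp [hA i j hij, hB i j hij]
    have h : polytope n ⊆ (doublyStochastic ℝ (Fin n) : Set (Matrix (Fin n) (Fin n) ℝ)) ∩
        {M | ∀ i j : Fin n, (i : ℕ) + 2 ≤ j → M i j = 0} := by
      refine convexHull_min ?_ (convex_doublyStochastic.inter hconv)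
      rintro _ ⟨⟨σ, rfl⟩, h⟩
      exact ⟨permMatrix_mem_doublyStochastic, h⟩
    intro hM
    obtain ⟨h1, h2⟩ := h hM
    obtain ⟨h3, h4, h5⟩ := mem_doublyStochastic_iff_sum.1 h1
    exact ⟨⟨h2, h4, h5⟩, h3⟩
  · rintro ⟨h, h0⟩
    obtain ⟨w, hw0, hw1, hw⟩ := exists_eq_sum_perm_of_mem_doublyStochastic
      (mem_doublyStochastic_iff_sum.2 ⟨h0, h.row, h.col⟩)
    classical
    -- Only permutations of nonzero weight are kept: as all terms are nonnegative, these inherit the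
    -- zeros of `M`.
    refine mem_convexHull_of_exists_fintype (ι := {σ : Equiv.Perm (Fin n) // w σ ≠ 0})
      (fun σ => w σ) (fun σ => σ.1.permMatrix ℝ) (fun σ => hw0 σ) ?_ ?_ ?_
    · rw [← hw1, ← Finset.sum_filter_ne_zero (s := univ) (f := w)]
      exact (Finset.sum_subtype _ (by simp) w).symm
    · rintro ⟨σ, hσ⟩
      refine ⟨⟨σ, rfl⟩, fun i j hij => ?_⟩
      have hz := h.zero i j hij
      rw [← hw, Matrix.sum_apply, Finset.sum_eq_zero_iff_of_nonneg] at hz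
      · simpa [hσ] using hz σ (mem_univ _)
      · intro τ _
        exact mul_nonneg (hw0 τ) (nonneg_of_mem_doublyStochastic permMatrix_mem_doublyStochastic)
    · rw [← hw, ← Finset.sum_subtype (univ.filter fun σ => w σ ≠ 0) (by simp)
        (fun σ => w σ • σ.permMatrix ℝ)]
      refine Finset.sum_subset (Finset.filter_subset _ _) fun σ _ hσ => ?_
      have : w σ = 0 := by simpa using hσ
      simp [this]

namespace IsHessenberg
variable {c c' : ℝ} {M N : Matrix (Fin n) (Fin n) ℝ}

theorem sub (hM : IsHessenberg c M) (hN : IsHessenberg c' N) : IsHessenberg (c - c') (M - N) where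
  zero i j h := by simp [hM.zero i j h, hN.zero i j h]
  row i := by simp [hM.row, hN.row]
  col i := by simp [hM.col, hN.col]

theorem add_smul (hM : IsHessenberg c M) (hN : IsHessenberg 0 N) (ε : ℝ) :
    IsHessenberg c (M + ε • N) where
  zero i j h := by simp [hM.zero i j h, hN.zero i j h]
  row i := by simp [sum_add_distrib, hM.row, ← mul_sum, hN.row]
  col i := by simp [sum_add_distrib, hM.col, ← mul_sum, hN.col]

theorem row_split (hM : IsHessenberg c M) {i i' : Fin n} (hi : (i' : ℕ) = i + 1) :
    (∑ j, if j ≤ i then M i j else 0) + M i i' = c := by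
  rw [← hM.row i]
  have : M i i' = ∑ j, if j = i' then M i j else 0 := by simp
  rw [this, ← sum_add_distrib]
  refine sum_congr rfl fun j _ => ?_
  by_cases h1 : j ≤ i
  · have : j ≠ i' := by rintro rfl; have := Fin.le_def.1 h1; omega
    simp [h1, this]
  · by_cases h2 : j = i'
    · rw [if_neg h1, if_pos h2, zero_add]
    · rw [if_neg h1, if_neg h2, hM.zero i j]
      · simp
      · have := Fin.le_def.not.1 h1
        have := Fin.val_ne_of_ne h2
        omega

theorem col_split (hM : IsHessenberg c M) {i i' : Fin n} (hi : (i' : ℕ) = i + 1) :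
    (∑ l, if i' ≤ l then M l i' else 0) + M i i' = c := by
  rw [← hM.col i']
  have : M i i' = ∑ l, if l = i then M l i' else 0 := by simp
  rw [this, ← sum_add_distrib]
  refine sum_congr rfl fun l _ => ?_
  by_cases h1 : i' ≤ l
  · have : l ≠ i := by rintro rfl; have := Fin.le_def.1 h1; omega
    simp [h1, this]
  · by_cases h2 : l = i
    · subst h2; simp [h1]
    · rw [if_neg h1, if_neg h2, hM.zero l i']
      · simp
      · have := Fin.le_def.not.1 h1
        have := Fin.val_ne_of_ne h2
        omega

/-- Conservation of flow across the cut above `i`. -/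
theorem cut (hM : IsHessenberg c M) {i i' : Fin n} (hi : (i' : ℕ) = i + 1) :
    M i i' = ∑ l, ∑ j, if i < l ∧ j ≤ i then M l j else 0 := by
  -- The rows up to `i` and the columns up to `i` are equally many, so their totals agree.
  -- Cancelling the common block leaves the upper right block, whose only possibly nonzero entry is
  -- `M i i'`, against the lower left one.
  have h1 : ∑ l, ∑ j, (if l ≤ i then M l j else 0) = ∑ l, ∑ j, if j ≤ i then M l j else 0 := by
    rw [sum_comm (f := fun l j => if j ≤ i then M l j else 0)]
    refine sum_congr rfl fun l _ => ?_
    split_ifs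
    · rw [hM.row, hM.col]
    · simp
  have h2 : ∑ l, ∑ j, (if l ≤ i ∧ i < j then M l j else 0) = M i i' := by
    rw [sum_eq_single i, sum_eq_single i']
    · rw [if_pos ⟨le_rfl, by rw [Fin.lt_def]; omega⟩]
    · intro j _ hj
      refine ite_eq_right_iff.2 fun h => hM.zero i j ?_
      have := Fin.lt_def.1 h.2
      have := Fin.val_ne_of_ne hj
      omega
    · simp
    · intro l _ hl
      refine sum_eq_zero fun j _ => ite_eq_right_iff.2 fun h => hM.zero l j ?_
      have := Fin.le_def.1 h.1
      have := Fin.lt_def.1 h.2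
      have := Fin.val_ne_of_ne hl
      omega
    · simp
  rw [← h2]
  refine sub_eq_zero.1 (Eq.trans ?_ (sub_eq_zero.2 h1))
  simp only [← sum_sub_distrib]
  refine sum_congr rfl fun l _ => sum_congr rfl fun j _ => ?_
  rcases le_or_gt l i with h | h <;> rcases le_or_gt j i with h' | h'
  · simp [h, h', not_lt.2 h, not_lt.2 h']
  · simp [h, h', not_lt.2 h, not_le.2 h']
  · simp [h, h', not_le.2 h, not_lt.2 h']
  · simp [not_le.2 h, not_le.2 h']

end IsHessenberg

/-! ### Supports of points -/

/-- The entries of `M` on and below the diagonal are supported in `H`. -/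
def SupportedIn (H : Fin n → Finset ℕ) (M : Matrix (Fin n) (Fin n) ℝ) : Prop :=
  ∀ i j : Fin n, j ≤ i → (j : ℕ) ∉ H i → M i j = 0

/-- The face of the polytope with support `H`. -/
def face (H : Fin n → Finset ℕ) : Set (Matrix (Fin n) (Fin n) ℝ) :=
  {M | M ∈ polytope n ∧ SupportedIn H M}

open Classical in
/-- The support of `M` on and below the diagonal, row by row. -/
noncomputable def lowerSupport (M : Matrix (Fin n) (Fin n) ℝ) (i : Fin n) : Finset ℕ :=
  (univ.filter fun j => j ≤ i ∧ M i j ≠ 0).map Fin.valEmbedding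

theorem mem_lowerSupport {M : Matrix (Fin n) (Fin n) ℝ} {i j : Fin n} :
    (j : ℕ) ∈ lowerSupport M i ↔ j ≤ i ∧ M i j ≠ 0 := by
  simp only [lowerSupport, mem_map, mem_filter, mem_univ, true_and, Fin.valEmbedding_apply]
  exact ⟨fun ⟨k, hk, h⟩ => by rwa [← Fin.ext h], fun h => ⟨j, h, rfl⟩⟩

theorem exists_of_mem_lowerSupport {M : Matrix (Fin n) (Fin n) ℝ} {i : Fin n} {v : ℕ}
    (h : v ∈ lowerSupport M i) : ∃ j : Fin n, (j : ℕ) = v ∧ j ≤ i ∧ M i j ≠ 0 := by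
  obtain ⟨j, hj, rfl⟩ := mem_map.1 h
  exact ⟨j, rfl, by simpa using hj⟩

theorem supportedIn_iff {H : Fin n → Finset ℕ} {M : Matrix (Fin n) (Fin n) ℝ} :
    SupportedIn H M ↔ ∀ i, lowerSupport M i ⊆ H i := by
  constructor
  · intro h i v hv
    obtain ⟨j, rfl, hj, hne⟩ := exists_of_mem_lowerSupport hv
    by_contra hv'
    exact hne (h i j hj hv')
  · intro h i j hj hH
    by_contra hne
    exact hH (h i (mem_lowerSupport.2 ⟨hj, hne⟩))

theorem sum_ite_ne_zero_iff {ι : Type*} [Fintype ι] {p : ι → Prop} [DecidablePred p] {f : ι → ℝ}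
    (hf : ∀ j, 0 ≤ f j) : (∑ j, if p j then f j else 0) ≠ 0 ↔ ∃ j, p j ∧ f j ≠ 0 := by
  rw [← not_iff_not, not_not, Finset.sum_eq_zero_iff_of_nonneg fun j _ => by
    split_ifs; exacts [hf j, le_rfl]]
  simp

/-- By `row_split` and `col_split` the inflow and the outflow of `v + 1` are both `1` minus the same
superdiagonal entry, so they vanish together. The source emits `1` and the sink receives `1`. -/
theorem isValid_lowerSupport {M : Matrix (Fin n) (Fin n) ℝ} (hM : M ∈ polytope n) :
    IsValid (lowerSupport M) := by
  obtain ⟨hM, h0⟩ := mem_polytope_iff.1 hM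
  have hrow : ∀ i, (lowerSupport M i).Nonempty ↔ (∑ j, if j ≤ i then M i j else 0) ≠ 0 := by
    intro i
    rw [sum_ite_ne_zero_iff (h0 i)]
    exact ⟨fun ⟨v, hv⟩ => (exists_of_mem_lowerSupport hv).imp fun j hj => hj.2,
      fun ⟨j, hj⟩ => ⟨j, mem_lowerSupport.2 hj⟩⟩
  have hcol : ∀ j : Fin n, (∃ i, (j : ℕ) ∈ lowerSupport M i) ↔
      (∑ i, if j ≤ i then M i j else 0) ≠ 0 := by
    intro j
    rw [sum_ite_ne_zero_iff fun i => h0 i j]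
    simp only [mem_lowerSupport]
  refine ⟨?_, ?_, ?_⟩
  · intro i v hv
    obtain ⟨j, rfl, hj, -⟩ := exists_of_mem_lowerSupport hv
    have := Fin.le_def.1 hj
    exact mem_range.2 (by omega)
  · intro v hv
    rw [hcol ⟨v, hv⟩]
    rcases v with - | v
    · refine iff_of_true (fun i hi => by omega) ?_
      have : (∑ i, if (⟨0, hv⟩ : Fin n) ≤ i then M i ⟨0, hv⟩ else 0) = 1 := by
        rw [← hM.col ⟨0, hv⟩]
        exact sum_congr rfl fun i _ => if_pos (Fin.le_def.2 (Nat.zero_le _))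
      rw [this]
      exact one_ne_zero
    · have hi : ((⟨v + 1, hv⟩ : Fin n) : ℕ) = (⟨v, by omega⟩ : Fin n) + 1 := rfl
      have h1 := hM.row_split hi
      have h2 := hM.col_split hi
      rw [show (∑ l, if (⟨v + 1, hv⟩ : Fin n) ≤ l then M l ⟨v + 1, hv⟩ else 0) =
        ∑ j, if j ≤ (⟨v, by omega⟩ : Fin n) then M ⟨v, by omega⟩ j else 0 by linarith, ← hrow]
      exact ⟨fun h => h _ rfl, fun h i hi => by rwa [show i = ⟨v, by omega⟩ from Fin.ext (by
        simpa using hi)]⟩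
  · intro i hi
    rw [hrow]
    have : (∑ j, if j ≤ i then M i j else 0) = 1 := by
      rw [← hM.row i]
      exact sum_congr rfl fun j _ => if_pos (Fin.le_def.2 (by omega))
    rw [this]
    exact one_ne_zero

/-- A point of the polytope can be moved in any direction of the face it lies inside of. -/
theorem exists_add_smul_mem {H : Fin n → Finset ℕ} {M N : Matrix (Fin n) (Fin n) ℝ}
    (hM : M ∈ polytope n) (hpos : ∀ i j : Fin n, (j : ℕ) ∈ H i → M i j ≠ 0)
    (hN : IsHessenberg 0 N) (hNH : SupportedIn H N) :
    ∃ ε : ℝ, 0 < ε ∧ M + ε • N ∈ polytope n := by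
  obtain ⟨hM, h0⟩ := mem_polytope_iff.1 hM
  have hlow : ∀ i j : Fin n, j ≤ i → M i j = 0 → N i j = 0 := fun i j hj h =>
    hNH i j hj fun hH => hpos i j hH h
  -- A superdiagonal zero of `M` is, by `cut`, a vanishing sum of nonnegative lower entries; hence
  -- these all vanish, `N` vanishes there too, and `cut` for `N` applies.
  have hMN : ∀ i j, M i j = 0 → N i j = 0 := by
    intro i j h
    rcases le_or_gt j i with hj | hj
    · exact hlow i j hj h
    · have hj := Fin.lt_def.1 hj
      rcases Nat.lt_or_ge j (i + 2) with h2 | h2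
      · have hij : (j : ℕ) = i + 1 := by omega
        rw [hM.cut hij, Finset.sum_eq_zero_iff_of_nonneg] at h
        · rw [hN.cut hij]
          refine sum_eq_zero fun l _ => sum_eq_zero fun k _ => ite_eq_right_iff.2 fun hlk => ?_
          have h3 := h l (mem_univ _)
          rw [Finset.sum_eq_zero_iff_of_nonneg fun j _ => by split_ifs; exacts [h0 _ _, le_rfl]] at h3
          have h4 := h3 k (mem_univ _)
          rw [if_pos hlk] at h4
          exact hlow l k (hlk.2.trans hlk.1.le) h4
        · exact fun l _ => sum_nonneg fun k _ => by split_ifs; exacts [h0 _ _, le_rfl]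
      · exact hN.zero i j h2
  have hev : ∀ᶠ ε : ℝ in nhdsWithin 0 (Set.Ioi 0), ∀ i j, 0 ≤ M i j + ε * N i j := by
    refine Filter.eventually_all.2 fun i => Filter.eventually_all.2 fun j => ?_
    rcases (h0 i j).eq_or_lt with h | h
    · simp [← h, hMN i j h.symm]
    · have hc : Filter.Tendsto (fun ε : ℝ => M i j + ε * N i j) (nhdsWithin 0 (Set.Ioi 0))
          (nhds (M i j + 0 * N i j)) :=
        (Continuous.tendsto (by fun_prop) 0).mono_left nhdsWithin_le_nhds
      exact (hc.eventually (lt_mem_nhds (by simpa using h))).mono fun ε hε => hε.le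
  obtain ⟨ε, hε, hpos⟩ := (hev.and self_mem_nhdsWithin).exists
  exact ⟨ε, hpos, mem_polytope_iff.2 ⟨hM.add_smul hN ε, by simpa using hε⟩⟩

/-! ### Realising a valid support by a random walk -/

/-- The out-degree of `v`. -/
def colCard (H : Fin n → Finset ℕ) (v : ℕ) : ℕ := #{i | v ∈ H i}

/-- The probability that the random walk along `H` from the source visits a vertex. -/
noncomputable def walk (H : Fin n → Finset ℕ) : ℕ → ℝ
  | 0 => 1
  | v + 1 => if h : v < n then
      ∑ j : Fin (v + 1), if (j : ℕ) ∈ H ⟨v, h⟩ then walk H j / colCard H j else 0 else 0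
  termination_by v => v
  decreasing_by exact j.2

theorem sum_fin_ite_mem {k : ℕ} {T : Finset ℕ} (hT : T ⊆ range k) (g : ℕ → ℝ) :
    (∑ j : Fin k, if (j : ℕ) ∈ T then g j else 0) = ∑ v ∈ T, g v := by
  rw [Fin.sum_univ_eq_sum_range (fun v => if v ∈ T then g v else 0) k, ← sum_filter,
    filter_mem_eq_inter, inter_eq_right.2 hT]

theorem walk_succ {H : Fin n → Finset ℕ} (hH : IsValid H) (i : Fin n) :
    walk H (i + 1) = ∑ v ∈ H i, walk H v / colCard H v := by
  rw [walk, dif_pos i.2, sum_fin_ite_mem (hH.sub i) fun v => walk H v / colCard H v]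

theorem colCard_pos {H : Fin n → Finset ℕ} (hH : IsValid H) {v : ℕ} (hv : v < n) :
    0 < colCard H v ↔ Alive H v := by
  rw [hH.alive_iff v hv, colCard, card_pos]
  simp [Finset.Nonempty]

theorem walk_pos {H : Fin n → Finset ℕ} (hH : IsValid H) {v : ℕ} (hv : v ≤ n) (h : Alive H v) :
    0 < walk H v := by
  induction v using Nat.strong_induction_on with
  | _ v ih =>
    rcases v with - | v
    · simp [walk]
    · have hi : ((⟨v, hv⟩ : Fin n) : ℕ) + 1 = v + 1 := rfl
      rw [← hi, walk_succ hH]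
      refine sum_pos (fun u hu => ?_) (h _ rfl)
      have huv := mem_range.1 (hH.sub _ hu)
      have hun : u < n := by simp at huv; omega
      have hua := (hH.alive_iff u hun).2 ⟨_, hu⟩
      exact div_pos (ih u huv hun.le hua) (by exact_mod_cast (colCard_pos hH hun).2 hua)

/-- Applied to row and column sums: computing the total of a matrix in two ways settles the one row
or column that the flow equations leave out. -/
theorem eq_of_sum_eq_sum {r s : Fin n → ℝ} {c : ℝ} (h : ∑ i, r i = ∑ i, s i) (hs : ∀ j, s j = c)
    (i₀ : Fin n) (hr : ∀ i, i ≠ i₀ → r i = c) : r i₀ = c := by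
  have : ∑ i, (r i - c) = 0 := by
    rw [sum_sub_distrib, h, ← sum_sub_distrib]
    simp [hs]
  rw [sum_eq_single i₀ (fun i _ hi => by rw [hr i hi, sub_self]) (by simp)] at this
  linarith

theorem sum_ite_eq_succ (i : Fin n) (g : ℕ → ℝ) :
    (∑ j : Fin n, if (j : ℕ) = i + 1 then g j else 0) = if (i : ℕ) + 1 < n then g (i + 1) else 0 := by
  rw [Fin.sum_univ_eq_sum_range (fun v => if v = i + 1 then g v else 0) n]
  simp

/-- Every valid `H` is the support of some point of the polytope. -/
theorem exists_lowerSupport_eq {H : Fin n → Finset ℕ} (hH : IsValid H) :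
    ∃ M ∈ polytope n, ∀ i, lowerSupport M i = H i := by
  classical
  -- The walk leaves each visited vertex along a uniformly chosen edge of `H`; an entry in `H` is
  -- the probability of traversing that edge, and a superdiagonal entry is the probability of
  -- skipping the vertex.
  let M : Matrix (Fin n) (Fin n) ℝ := fun i j =>
    (if (j : ℕ) ∈ H i then walk H j / colCard H j else 0) +
      if (j : ℕ) = i + 1 then 1 - walk H j else 0
  have hsub : ∀ i j : Fin n, (j : ℕ) ∈ H i → (j : ℕ) ≤ i := fun i j h => by
    have := mem_range.1 (hH.sub i h)
    omega
  have hpos : ∀ i j : Fin n, (j : ℕ) ∈ H i → 0 < walk H j / colCard H j := fun i j h => by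
    have := (hH.alive_iff j j.2).2 ⟨i, h⟩
    exact div_pos (walk_pos hH j.2.le this) (by exact_mod_cast (colCard_pos hH j.2).2 this)
  have hlow : ∀ i j : Fin n, j ≤ i →
      M i j = if (j : ℕ) ∈ H i then walk H j / colCard H j else 0 := by
    intro i j hj
    have : (j : ℕ) ≠ i + 1 := by have := Fin.le_def.1 hj; omega
    simp [M, this]
  have hcol : ∀ j, ∑ i, M i j = 1 := by
    intro j
    simp only [M, sum_add_distrib]
    rw [← sum_filter, sum_const, nsmul_eq_mul]
    change (colCard H j : ℝ) * _ + _ = 1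
    have hmul : (colCard H j : ℝ) * (walk H j / colCard H j) =
        if Alive H j then walk H j else 0 := by
      split_ifs with h
      · have := (colCard_pos hH j.2).2 h
        field_simp
      · have := (colCard_pos hH j.2).not.2 h
        simp [show colCard H j = 0 by omega]
    rw [hmul]
    obtain ⟨v, hv⟩ := j
    rcases v with - | v
    · have : Alive H 0 := fun i hi => by omega
      simp [this, walk]
    · have h1 : (∑ i : Fin n, if v + 1 = (i : ℕ) + 1 then 1 - walk H (v + 1) else 0) =
          1 - walk H (v + 1) := by
        rw [sum_eq_single ⟨v, by omega⟩]
        · simp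
        · intro i _ hi
          have := Fin.val_ne_of_ne hi
          exact if_neg fun h => this (by simp; omega)
        · simp
      rw [h1]
      split_ifs with h
      · ring
      · have h2 := walk_succ hH ⟨v, by omega⟩
        have h3 : H ⟨v, by omega⟩ = ∅ := by
          by_contra hne
          refine h fun i hi => ?_
          rw [show i = ⟨v, by omega⟩ from Fin.ext (by simpa using hi)]
          exact nonempty_iff_ne_empty.2 hne
        rw [h3] at h2
        simp only [sum_empty] at h2
        simp [h2]
  have hrow' : ∀ i : Fin n, (i : ℕ) + 1 < n → ∑ j, M i j = 1 := by
    intro i hi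
    simp only [M, sum_add_distrib]
    rw [sum_fin_ite_mem ((hH.sub i).trans (range_subset_range.2 (by omega)))
      fun v => walk H v / colCard H v, ← walk_succ hH, sum_ite_eq_succ i fun v => 1 - walk H v,
      if_pos hi]
    ring
  have hrow : ∀ i, ∑ j, M i j = 1 := by
    intro i
    by_cases hi : (i : ℕ) + 1 < n
    · exact hrow' i hi
    · refine eq_of_sum_eq_sum (r := fun i => ∑ j, M i j) sum_comm hcol i fun k hk => hrow' k ?_
      have := Fin.val_ne_of_ne hk
      omega
  have hM : IsHessenberg 1 M := by
    refine ⟨fun i j hij => ?_, hrow, hcol⟩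
    have h1 : (j : ℕ) ∉ H i := fun h => by have := hsub i j h; omega
    have h2 : (j : ℕ) ≠ i + 1 := by omega
    simp [M, h1, h2]
  have h0low : ∀ i j : Fin n, j ≤ i → 0 ≤ M i j := by
    intro i j hj
    rw [hlow i j hj]
    split_ifs with h
    · exact (hpos i j h).le
    · exact le_rfl
  refine ⟨M, mem_polytope_iff.2 ⟨hM, fun i j => ?_⟩, fun i => ?_⟩
  · rcases le_or_gt j i with hj | hj
    · exact h0low i j hj
    · have hj := Fin.lt_def.1 hj
      rcases Nat.lt_or_ge j (i + 2) with h2 | h2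
      · rw [hM.cut (show (j : ℕ) = i + 1 by omega)]
        refine sum_nonneg fun l _ => sum_nonneg fun k _ => ?_
        split_ifs with h
        · exact h0low l k (h.2.trans h.1.le)
        · exact le_rfl
      · rw [hM.zero i j h2]
  · ext v
    constructor
    · intro hv
      obtain ⟨j, rfl, hj, hne⟩ := exists_of_mem_lowerSupport hv
      by_contra h
      rw [hlow i j hj, if_neg h] at hne
      exact hne rfl
    · intro hv
      have hvi := mem_range.1 (hH.sub i hv)
      have hj : (⟨v, by omega⟩ : Fin n) ≤ i := Fin.le_def.2 (by simp; omega)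
      refine (mem_lowerSupport (j := ⟨v, by omega⟩)).2 ⟨hj, ?_⟩
      rw [hlow i _ hj, if_pos hv]
      exact (hpos i ⟨v, by omega⟩ hv).ne'

/-! ### Nonempty faces are exactly the valid supports -/

/-- The functional is minus the total of the lower entries outside `H`. Its maximum `0` is attained
because `H` is the support of some point. -/
theorem isExposed_face {H : Fin n → Finset ℕ} (hH : IsValid H) :
    IsExposed ℝ (polytope n) (face H) := by
  intro _
  let l : Matrix (Fin n) (Fin n) ℝ →ₗ[ℝ] ℝ :=
    { toFun := fun M => -∑ i, ∑ j, if j ≤ i ∧ (j : ℕ) ∉ H i then M i j else 0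
      map_add' := fun A B => by
        rw [← neg_add, ← sum_add_distrib]
        congr 1
        refine sum_congr rfl fun i _ => ?_
        rw [← sum_add_distrib]
        refine sum_congr rfl fun j _ => ?_
        split_ifs <;> simp
      map_smul' := fun a A => by simp [mul_sum] }
  have hle : ∀ M ∈ polytope n, l M ≤ 0 := fun M hM =>
    neg_nonpos.2 <| sum_nonneg fun i _ => sum_nonneg fun j _ => by
      split_ifs
      exacts [(mem_polytope_iff.1 hM).2 i j, le_rfl]
  have heq : ∀ M ∈ polytope n, l M = 0 ↔ SupportedIn H M := by
    intro M hM
    have h0 := (mem_polytope_iff.1 hM).2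
    have hterm : ∀ i j : Fin n, 0 ≤ if j ≤ i ∧ (j : ℕ) ∉ H i then M i j else 0 := fun i j => by
      split_ifs
      exacts [h0 i j, le_rfl]
    change -∑ i, ∑ j, _ = _ ↔ _
    rw [neg_eq_zero, Finset.sum_eq_zero_iff_of_nonneg fun i _ => sum_nonneg fun j _ => hterm i j]
    simp only [Finset.sum_eq_zero_iff_of_nonneg fun j _ => hterm _ j]
    simp [SupportedIn]
  obtain ⟨M₀, hM₀, hs⟩ := exists_lowerSupport_eq hH
  have hl₀ : l M₀ = 0 := (heq M₀ hM₀).2 (supportedIn_iff.2 fun i => (hs i).subset)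
  refine ⟨LinearMap.toContinuousLinearMap l, ?_⟩
  ext M
  simp only [face, Set.mem_ofPred_eq, LinearMap.coe_toContinuousLinearMap']
  refine and_congr_right fun hM => ?_
  rw [← heq M hM]
  exact ⟨fun h y hy => h ▸ hle y hy, fun h => le_antisymm (hle M hM) (hl₀ ▸ h M₀ hM₀)⟩

theorem face_nonempty {H : Fin n → Finset ℕ} (hH : IsValid H) : (face H).Nonempty := by
  obtain ⟨M, hM, hs⟩ := exists_lowerSupport_eq hH
  exact ⟨M, hM, supportedIn_iff.2 fun i => (hs i).subset⟩

theorem face_injOn : Set.InjOn (face (n := n)) {H | IsValid H} := by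
  have h : ∀ H H' : Fin n → Finset ℕ, IsValid H → face H ⊆ face H' → ∀ i, H i ⊆ H' i := by
    intro H H' hH hsub i
    obtain ⟨M, hM, hs⟩ := exists_lowerSupport_eq hH
    have := hsub ⟨hM, supportedIn_iff.2 fun i => (hs i).subset⟩
    exact hs i ▸ supportedIn_iff.1 this.2 i
  intro H hH H' hH' heq
  ext1 i
  exact (h H H' hH heq.subset i).antisymm (h H' H hH' heq.superset i)

/-- A point `M₀` of `A` with the largest support plays the role of a relative interior point. -/
theorem exists_eq_face {A : Set (Matrix (Fin n) (Fin n) ℝ)} (hA : IsExposed ℝ (polytope n) A)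
    (hne : A.Nonempty) : ∃ H, IsValid H ∧ A = face H := by
  have hconv : Convex ℝ A := hA.convex (convex_convexHull ℝ _)
  obtain ⟨l, hl⟩ := hA hne
  have hbdd : ∀ M : Matrix (Fin n) (Fin n) ℝ, ∑ i, #(lowerSupport M i) ≤ n * n := by
    intro M
    calc _ ≤ ∑ _i : Fin n, n := sum_le_sum fun i _ => by
          rw [lowerSupport, card_map]
          exact (card_filter_le _ _).trans (by simp)
      _ = n * n := by simp
  obtain ⟨M₀, hM₀, hmax⟩ : ∃ M₀ ∈ A, ∀ M ∈ A,
      ∑ i, #(lowerSupport M i) ≤ ∑ i, #(lowerSupport M₀ i) := by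
    have hfin : ((fun M => ∑ i, #(lowerSupport M i)) '' A).Finite :=
      (Set.finite_Iic (n * n)).subset (by rintro _ ⟨M, -, rfl⟩; exact hbdd M)
    obtain ⟨_, ⟨M₀, hM₀, rfl⟩, h⟩ := Set.exists_max_image _ id hfin (hne.image _)
    exact ⟨M₀, hM₀, fun M hM => h _ ⟨M, hM, rfl⟩⟩
  have hP : ∀ M ∈ A, M ∈ polytope n := fun M hM => hA.subset hM
  refine ⟨lowerSupport M₀, isValid_lowerSupport (hP M₀ hM₀), Set.Subset.antisymm ?_ ?_⟩
  · intro M hM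
    refine ⟨hP M hM, supportedIn_iff.2 ?_⟩
    -- The support of the midpoint contains both supports, so maximality puts that of `M` inside
    -- that of `M₀`.
    let B := (1 / 2 : ℝ) • M + (1 / 2 : ℝ) • M₀
    have hB : B ∈ A := hconv hM hM₀ (by norm_num) (by norm_num) (by norm_num)
    have h0 := (mem_polytope_iff.1 (hP M hM)).2
    have h0' := (mem_polytope_iff.1 (hP M₀ hM₀)).2
    have hBM : ∀ i, lowerSupport M i ⊆ lowerSupport B i := by
      intro i v hv
      obtain ⟨j, rfl, hj, hne⟩ := exists_of_mem_lowerSupport hv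
      refine mem_lowerSupport.2 ⟨hj, ?_⟩
      have h1 := (h0 i j).lt_of_ne hne.symm
      have h2 := h0' i j
      simp only [B, Matrix.add_apply, Matrix.smul_apply, smul_eq_mul]
      positivity
    have hBM₀ : ∀ i, lowerSupport M₀ i ⊆ lowerSupport B i := by
      intro i v hv
      obtain ⟨j, rfl, hj, hne⟩ := exists_of_mem_lowerSupport hv
      refine mem_lowerSupport.2 ⟨hj, ?_⟩
      have h1 := (h0' i j).lt_of_ne hne.symm
      have h2 := h0 i j
      simp only [B, Matrix.add_apply, Matrix.smul_apply, smul_eq_mul]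
      positivity
    have heq := (sum_eq_sum_iff_of_le fun i _ => card_le_card (hBM₀ i)).1
      (le_antisymm (sum_le_sum fun i _ => card_le_card (hBM₀ i)) (hmax B hB))
    intro i
    rw [eq_of_subset_of_card_le (hBM₀ i) (heq i (mem_univ _)).ge]
    exact hBM i
  · rintro M ⟨hM, hMs⟩
    have hN : IsHessenberg 0 (M₀ - M) := by
      simpa using (mem_polytope_iff.1 (hP M₀ hM₀)).1.sub (mem_polytope_iff.1 hM).1
    have hNs : SupportedIn (lowerSupport M₀) (M₀ - M) := by
      intro i j hj hH
      rw [Matrix.sub_apply, hMs i j hj hH, supportedIn_iff.2 (fun _ => subset_rfl) i j hj hH,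
        sub_zero]
    -- The segment from `M` to `M₀` extends beyond `M₀` inside the polytope. As `l` is maximal at
    -- `M₀`, it cannot be smaller at `M`.
    obtain ⟨ε, hε, hmem⟩ := exists_add_smul_mem (hP M₀ hM₀)
      (fun i j h => (mem_lowerSupport.1 h).2) hN hNs
    rw [hl] at hM₀ ⊢
    have h1 := hM₀.2 _ hmem
    rw [map_add, map_smul, map_sub, smul_eq_mul] at h1
    have h2 : l M₀ ≤ l M := by
      by_contra! h
      have := mul_pos hε (sub_pos.2 h)
      linarith
    exact ⟨hM, fun y hy => (hM₀.2 y hy).trans h2⟩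

/-! ### Dimension of a face -/

/-- The matrix with the given entries on `H` and zeros elsewhere. -/
def lowerMatrix (H : Fin n → Finset ℕ) :
    ((i : Fin n) → H i → ℝ) →ₗ[ℝ] Matrix (Fin n) (Fin n) ℝ where
  toFun f := Matrix.of fun i j => if h : (j : ℕ) ∈ H i then f i ⟨j, h⟩ else 0
  map_add' f g := by
    ext i j
    by_cases h : (j : ℕ) ∈ H i <;> simp [h]
  map_smul' a f := by
    ext i j
    by_cases h : (j : ℕ) ∈ H i <;> simp [h]

theorem lowerMatrix_apply (H : Fin n → Finset ℕ) (f : (i : Fin n) → H i → ℝ) (i j : Fin n) :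
    lowerMatrix H f i j = if h : (j : ℕ) ∈ H i then f i ⟨j, h⟩ else 0 := rfl

/-- The net flow into the vertices `1, …, n`. -/
def netFlow (n : ℕ) : Matrix (Fin n) (Fin n) ℝ →ₗ[ℝ] (Fin n → ℝ) where
  toFun M := fun i => ∑ j, M i j - ∑ j : Fin n, if (j : ℕ) = i + 1 then ∑ l, M l j else 0
  map_add' A B := by
    ext i
    simp only [Matrix.add_apply, sum_add_distrib, Pi.add_apply, ite_add_zero]
    ring
  map_smul' a A := by
    ext i
    simp only [Matrix.smul_apply, ← smul_sum, Pi.smul_apply, smul_sub, RingHom.id_apply,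
      ← smul_ite_zero]

/-- Fill in the superdiagonal so that the row sums vanish. -/
def fillDiagonal (n : ℕ) : Matrix (Fin n) (Fin n) ℝ →ₗ[ℝ] Matrix (Fin n) (Fin n) ℝ where
  toFun M := Matrix.of fun i j => M i j - if (j : ℕ) = i + 1 then ∑ k, M i k else 0
  map_add' A B := by
    ext i j
    simp only [Matrix.add_apply, Matrix.of_apply, sum_add_distrib, ite_add_zero]
    ring
  map_smul' a A := by
    ext i j
    simp [← mul_sum, mul_sub]

/-- The net flow into the visited vertices other than the source. -/
def conservation (H : Fin n → Finset ℕ) :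
    ((i : Fin n) → H i → ℝ) →ₗ[ℝ] ({i : Fin n // (H i).Nonempty} → ℝ) :=
  (LinearMap.funLeft ℝ ℝ Subtype.val) ∘ₗ netFlow n ∘ₗ lowerMatrix H

theorem conservation_apply (H : Fin n → Finset ℕ) (f : (i : Fin n) → H i → ℝ)
    (i : {i : Fin n // (H i).Nonempty}) : conservation H f i = ∑ j, lowerMatrix H f i j -
      ∑ j : Fin n, if (j : ℕ) = i + 1 then ∑ l, lowerMatrix H f l j else 0 := rfl

theorem fillDiagonal_apply (M : Matrix (Fin n) (Fin n) ℝ) (i j : Fin n) :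
    fillDiagonal n M i j = M i j - if (j : ℕ) = i + 1 then ∑ k, M i k else 0 := rfl

theorem fillDiagonal_lowerMatrix_of_le (H : Fin n → Finset ℕ) (f : (i : Fin n) → H i → ℝ)
    {i j : Fin n} (h : j ≤ i) : fillDiagonal n (lowerMatrix H f) i j = lowerMatrix H f i j := by
  have : (j : ℕ) ≠ i + 1 := by have := Fin.le_def.1 h; omega
  simp [fillDiagonal_apply, this]

theorem fillDiagonal_lowerMatrix_injective {H : Fin n → Finset ℕ} (hH : IsValid H) :
    Function.Injective (fillDiagonal n ∘ₗ lowerMatrix H) := by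
  intro f g hfg
  ext i ⟨v, hv⟩
  have hvi := mem_range.1 (hH.sub i hv)
  have hj : (⟨v, by omega⟩ : Fin n) ≤ i := Fin.le_def.2 (by simp; omega)
  have h := congrFun (congrFun hfg i) ⟨v, by omega⟩
  simp only [LinearMap.comp_apply] at h
  rw [fillDiagonal_lowerMatrix_of_le H f hj, fillDiagonal_lowerMatrix_of_le H g hj] at h
  simpa [lowerMatrix_apply, hv] using h

/-- A unit of flow on an edge from `v` to `i + 1` has net inflow `1` at `i + 1` and `-1` at `v`,
with no second term when `v` is the source. Following incoming edges back to the source produces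
every basis vector by induction. -/
theorem conservation_surjective {H : Fin n → Finset ℕ} (hH : IsValid H) :
    LinearMap.range (conservation H) = ⊤ := by
  classical
  have key : ∀ (k : ℕ) (i : {i : Fin n // (H i).Nonempty}), (i : ℕ) = k →
      (Pi.single i 1 : {i : Fin n // (H i).Nonempty} → ℝ) ∈ LinearMap.range (conservation H) := by
    intro k
    induction k using Nat.strong_induction_on with
    | _ k ih =>
      rintro ⟨i, hi⟩ rfl
      obtain ⟨v, hv⟩ := id hi
      have hvi := mem_range.1 (hH.sub i hv)
      let f : (i : Fin n) → H i → ℝ := Pi.single i (Pi.single ⟨v, hv⟩ 1)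
      have hf : ∀ l j : Fin n, lowerMatrix H f l j =
          if l = i then (if (j : ℕ) = v then 1 else 0) else 0 := by
        intro l j
        rw [lowerMatrix_apply]
        by_cases hl : l = i
        · subst hl
          by_cases hj : (j : ℕ) = v
          · subst hj
            simp [f, hv]
          · by_cases hjl : (j : ℕ) ∈ H l <;> simp [f, hj, hjl]
        · simp [f, hl]
      have hrow : ∀ l : Fin n, (∑ j, lowerMatrix H f l j) = if l = i then 1 else 0 := by
        intro l
        simp only [hf]
        split_ifs
        · rw [sum_eq_single ⟨v, by omega⟩]
          · simp
          · intro j _ hj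
            exact if_neg fun h => hj (Fin.ext h)
          · simp
        · simp
      have hcol : ∀ j : Fin n, (∑ l, lowerMatrix H f l j) = if (j : ℕ) = v then 1 else 0 := by
        intro j
        simp [hf]
      have hval : ∀ l : {i : Fin n // (H i).Nonempty}, conservation H f l =
          (if l.1 = i then 1 else 0) - if (l : ℕ) + 1 = v then 1 else 0 := by
        intro l
        rw [conservation_apply, hrow]
        simp only [hcol]
        rw [sum_ite_eq_succ l.1 fun u => if u = v then 1 else 0]
        congr 1
        by_cases h : (l : ℕ) + 1 = v
        · rw [if_pos (by omega)]
        · simp [h]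
      rcases v with - | v
      · refine ⟨f, ?_⟩
        ext l
        rw [hval]
        by_cases h : l.1 = i
        · obtain rfl : l = ⟨i, hi⟩ := Subtype.ext h
          simp
        · have : l ≠ ⟨i, hi⟩ := fun h' => h (congrArg Subtype.val h')
          simp [h, this]
      · have hne : (H ⟨v, by omega⟩).Nonempty :=
          (hH.alive_iff (v + 1) (by omega)).2 ⟨i, hv⟩ _ rfl
        have h1 := ih v (show v < (i : ℕ) by omega) ⟨⟨v, by omega⟩, hne⟩ rfl
        have h2 : (Pi.single ⟨i, hi⟩ 1 : {i : Fin n // (H i).Nonempty} → ℝ) =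
            conservation H f + Pi.single ⟨⟨v, by omega⟩, hne⟩ 1 := by
          ext l
          rw [Pi.add_apply, hval]
          have e1 : l = ⟨i, hi⟩ ↔ l.1 = i := Subtype.ext_iff
          have e2 : l = ⟨⟨v, by omega⟩, hne⟩ ↔ (l : ℕ) + 1 = v + 1 := by
            rw [Subtype.ext_iff, Fin.ext_iff]
            simp
          simp only [Pi.single_apply, e1, e2]
          ring
        rw [h2]
        exact add_mem (LinearMap.mem_range_self _ f) h1
  rw [eq_top_iff, ← (Pi.basisFun ℝ {i : Fin n // (H i).Nonempty}).span_eq, Submodule.span_le]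
  rintro _ ⟨i, rfl⟩
  rw [Pi.basisFun_apply]
  exact key i i rfl

theorem finrank_ker_conservation {H : Fin n → Finset ℕ} (hH : IsValid H) :
    Module.finrank ℝ (LinearMap.ker (conservation H)) = faceDim H := by
  have h := LinearMap.finrank_range_add_finrank_ker (conservation H)
  rw [conservation_surjective hH, finrank_top, Module.finrank_fintype_fun_eq_card,
    Module.finrank_pi_fintype] at h
  simp only [Module.finrank_fintype_fun_eq_card, Fintype.card_coe, Fintype.card_subtype] at h
  -- An empty row contributes `0` on both sides, by truncated subtraction.
  have h2 : #{i | (H i).Nonempty} + faceDim H = ∑ i, #(H i) := by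
    rw [faceDim, card_filter, ← sum_add_distrib]
    refine sum_congr rfl fun i _ => ?_
    rcases (H i).eq_empty_or_nonempty with h | h
    · simp [h]
    · have := h.card_pos
      rw [if_pos h]
      omega
  omega

theorem lowerMatrix_eq_zero {H : Fin n → Finset ℕ} (hH : IsValid H) (f : (i : Fin n) → H i → ℝ)
    {i j : Fin n} (h : i < j) : lowerMatrix H f i j = 0 := by
  rw [lowerMatrix_apply, dif_neg]
  intro hj
  have := mem_range.1 (hH.sub i hj)
  have := Fin.lt_def.1 h
  omega

/-- Once the superdiagonal makes row `i` sum to zero, column `i + 1` sums to zero exactly when flow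
is conserved at vertex `i + 1`. -/
theorem mem_map_ker_iff {H : Fin n → Finset ℕ} (hH : IsValid H)
    {N : Matrix (Fin n) (Fin n) ℝ} :
    N ∈ (LinearMap.ker (conservation H)).map (fillDiagonal n ∘ₗ lowerMatrix H) ↔
      IsHessenberg 0 N ∧ SupportedIn H N := by
  constructor
  · rintro ⟨f, hf, rfl⟩
    have hf : ∀ i : {i : Fin n // (H i).Nonempty}, _ = (0 : ℝ) :=
      fun i => congrFun (LinearMap.mem_ker.1 hf) i
    simp only [conservation_apply] at hf
    simp only [LinearMap.comp_apply]
    set M := lowerMatrix H f with hMdef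
    have hcolval : ∀ i i' : Fin n, (i' : ℕ) = i + 1 →
        (∑ j : Fin n, if (j : ℕ) = i + 1 then ∑ l, M l j else 0) = ∑ l, M l i' := by
      intro i i' hi
      rw [sum_eq_single i', if_pos hi]
      · exact fun j _ hj => if_neg fun h => hj (Fin.ext (h.trans hi.symm))
      · simp
    have hrow : ∀ i, ∑ j, fillDiagonal n M i j = 0 := by
      intro i
      simp only [fillDiagonal_apply, sum_sub_distrib]
      rw [sum_ite_eq_succ i fun _ => ∑ k, M i k]
      split_ifs with hi
      · ring
      · rw [sub_zero]
        -- The last row has no superdiagonal entry; its sum vanishes by conservation at the sink,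
        -- which is alive.
        have h := hf ⟨i, hH.alive_last i (by omega)⟩
        rw [sum_eq_zero (s := univ) (f := fun j : Fin n => if (j : ℕ) = i + 1 then
          ∑ l, M l j else 0) fun j _ => if_neg (by omega), sub_zero] at h
        exact h
    have hcol' : ∀ j : Fin n, (j : ℕ) ≠ 0 → ∑ i, fillDiagonal n M i j = 0 := by
      intro j hj
      obtain ⟨i, hi⟩ : ∃ i : Fin n, (j : ℕ) = i + 1 :=
        ⟨⟨(j : ℕ) - 1, by omega⟩, by simp; omega⟩
      simp only [fillDiagonal_apply, sum_sub_distrib]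
      rw [sum_eq_single (s := univ) (f := fun l : Fin n => if (j : ℕ) = l + 1 then
        ∑ k, M l k else 0) i (fun l _ hl => if_neg fun h => hl (Fin.ext (by omega))) (by simp),
        if_pos hi]
      by_cases hne : (H i).Nonempty
      · have h := hf ⟨i, hne⟩
        rw [hcolval i j hi] at h
        linarith
      -- No conservation law is imposed at an unvisited vertex, but there both inflow and outflow
      -- are empty.
      · have h1 : ∑ k, M i k = 0 := sum_eq_zero fun k _ => by
          rw [hMdef, lowerMatrix_apply, dif_neg fun h => hne ⟨_, h⟩]
        have h2 : ∑ l, M l j = 0 := sum_eq_zero fun l _ => by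
          rw [hMdef, lowerMatrix_apply, dif_neg fun h => hne ?_]
          exact (hH.alive_iff j j.2).2 ⟨l, h⟩ i hi.symm
        rw [h1, h2, sub_zero]
    refine ⟨⟨fun i j hij => ?_, hrow, fun j => ?_⟩, fun i j hj hjH => ?_⟩
    · rw [fillDiagonal_apply, hMdef, lowerMatrix_eq_zero hH f (i := i) (j := j)
        (Fin.lt_def.2 (by omega)),
        if_neg (by omega), sub_zero]
    · by_cases hj : (j : ℕ) = 0
      · refine eq_of_sum_eq_sum (r := fun j => ∑ i, fillDiagonal n M i j) sum_comm hrow j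
          fun k hk => hcol' k fun h => hk (Fin.ext (h.trans hj.symm))
      · exact hcol' j hj
    · rw [fillDiagonal_lowerMatrix_of_le H f hj, lowerMatrix_apply, dif_neg hjH]
  · rintro ⟨hN, hNH⟩
    let f : (i : Fin n) → H i → ℝ := fun i v =>
      N i ⟨v, by have := mem_range.1 (hH.sub i v.2); omega⟩
    have hM : ∀ i j, lowerMatrix H f i j = if j ≤ i then N i j else 0 := by
      intro i j
      rw [lowerMatrix_apply]
      by_cases h : (j : ℕ) ∈ H i
      · have := mem_range.1 (hH.sub i h)
        rw [dif_pos h, if_pos (Fin.le_def.2 (by omega))]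
      · rw [dif_neg h]
        split_ifs with hj
        · exact (hNH i j hj h).symm
        · rfl
    refine ⟨f, LinearMap.mem_ker.2 (funext fun i => ?_), ?_⟩
    · rw [conservation_apply, Pi.zero_apply]
      simp only [hM]
      by_cases hi : (i : ℕ) + 1 < n
      · have h1 := hN.row_split (i := i.1) (i' := ⟨i + 1, hi⟩) rfl
        have h2 := hN.col_split (i := i.1) (i' := ⟨i + 1, hi⟩) rfl
        rw [sum_eq_single (s := univ) (f := fun j : Fin n => if (j : ℕ) = i + 1 then
          ∑ l, (if j ≤ l then N l j else 0) else 0) ⟨i + 1, hi⟩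
          (fun j _ hj => if_neg fun h => hj (Fin.ext h)) (by simp), if_pos rfl]
        linarith
      · rw [sum_eq_zero (s := univ) (f := fun j : Fin n => if (j : ℕ) = i + 1 then
          ∑ l, (if j ≤ l then N l j else 0) else 0) fun j _ => if_neg (by omega), sub_zero,
          ← hN.row i.1]
        exact sum_congr rfl fun j _ => if_pos (Fin.le_def.2 (by omega))
    · ext i j
      rw [LinearMap.comp_apply, fillDiagonal_apply]
      simp only [hM]
      rcases le_or_gt j i with hj | hj
      · have := Fin.le_def.1 hj
        rw [if_pos hj, if_neg (by omega), sub_zero]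
      · have hj' := Fin.lt_def.1 hj
        rw [if_neg (not_le.2 hj)]
        split_ifs with h
        · have := hN.row_split h
          linarith
        · rw [hN.zero i j (by omega), sub_zero]

/-- A point with support exactly `H` can be moved a little in every admissible direction, so all of
these are differences of points of the face up to scaling. -/
theorem vectorSpan_face {H : Fin n → Finset ℕ} (hH : IsValid H) :
    vectorSpan ℝ (face H) =
      (LinearMap.ker (conservation H)).map (fillDiagonal n ∘ₗ lowerMatrix H) := by
  apply le_antisymm
  · rw [vectorSpan_def, Submodule.span_le]
    rintro _ ⟨A, hA, B, hB, rfl⟩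
    rw [SetLike.mem_coe, mem_map_ker_iff hH]
    refine ⟨by simpa using (mem_polytope_iff.1 hA.1).1.sub (mem_polytope_iff.1 hB.1).1,
      fun i j hj h => ?_⟩
    simp [hA.2 i j hj h, hB.2 i j hj h]
  · intro N hN
    obtain ⟨hN0, hNH⟩ := (mem_map_ker_iff hH).1 hN
    obtain ⟨M, hM, hs⟩ := exists_lowerSupport_eq hH
    have hMH : SupportedIn H M := supportedIn_iff.2 fun i => (hs i).subset
    obtain ⟨ε, hε, hmem⟩ := exists_add_smul_mem hM
      (fun i j h => (mem_lowerSupport.1 (hs i ▸ h)).2) hN0 hNH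
    have h1 : M + ε • N ∈ face H :=
      ⟨hmem, fun i j hj h => by simp [hMH i j hj h, hNH i j hj h]⟩
    have h2 := vsub_mem_vectorSpan ℝ h1 ⟨hM, hMH⟩
    rw [vsub_eq_sub, add_sub_cancel_left] at h2
    exact (Submodule.smul_mem_iff _ hε.ne').1 h2

theorem dimension_face {H : Fin n → Finset ℕ} (hH : IsValid H) :
    dimension (face H) = faceDim H := by
  rw [dimension, if_neg (face_nonempty hH).ne_empty, vectorSpan_face hH,
    ← finrank_ker_conservation hH]
  congr 1
  exact (LinearEquiv.finrank_eq (Submodule.equivMapOfInjective _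
    (fillDiagonal_lowerMatrix_injective hH) _)).symm

/-! ### Counting the faces -/

theorem facesOfDim_polytope (n : ℕ) (d : ℤ) : facesOfDim (polytope n) d =
    (if d = -1 then {∅} else ∅) ∪
      face '' (({H ∈ validSets n | (faceDim H : ℤ) = d} : Finset _) : Set _) := by
  ext A
  simp only [facesOfDim, Set.mem_ofPred_eq, Set.mem_union, Set.mem_image, coe_filter,
    mem_validSets]
  constructor
  · rintro ⟨hA, hd⟩
    rcases A.eq_empty_or_nonempty with rfl | hne
    · left
      have : d = -1 := by simpa [dimension] using hd.symm
      simp [this]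
    · right
      obtain ⟨H, hH, rfl⟩ := exists_eq_face hA hne
      exact ⟨H, ⟨hH, by rw [← dimension_face hH, hd]⟩, rfl⟩
  · rintro (h | ⟨H, ⟨hH, hd⟩, rfl⟩)
    · split_ifs at h with hd
      · obtain rfl : A = ∅ := h
        exact ⟨isExposed_empty, by simp [dimension, hd]⟩
      · exact h.elim
    · exact ⟨isExposed_face hH, by rw [dimension_face hH, hd]⟩

theorem ncard_facesOfDim_polytope (n : ℕ) (d : ℤ) : (facesOfDim (polytope n) d).ncard =
    (if d = -1 then 1 else 0) + #{H ∈ validSets n | (faceDim H : ℤ) = d} := by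
  have hinj : Set.InjOn (face (n := n))
      (({H ∈ validSets n | (faceDim H : ℤ) = d} : Finset _) : Set _) :=
    face_injOn.mono fun H hH => mem_validSets.1 (mem_filter.1 hH).1
  rw [facesOfDim_polytope, Set.ncard_union_eq ?_ (by split_ifs <;> simp)
    ((Finset.finite_toSet _).image _), hinj.ncard_image, Set.ncard_coe_finset]
  · split_ifs <;> simp
  · rw [Set.disjoint_right]
    rintro _ ⟨H, hH, rfl⟩ h
    split_ifs at h
    · exact (face_nonempty (mem_validSets.1 (mem_filter.1 hH).1)).ne_empty h
    · exact h

end CRY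

theorem mainTheorem4 (n : ℕ) (d : ℤ) :
    (CRY.facesOfDim (CRY.polytope n) d).Finite ∧
      ((CRY.facesOfDim (CRY.polytope n) d).ncard : ℚ) =
        (PowerSeries.coeff n CRY.F).coeff d := by
  constructor
  · rw [CRY.facesOfDim_polytope]
    refine Set.Finite.union ?_ ((Finset.finite_toSet _).image _)
    split_ifs <;> simp
  · rw [CRY.ncard_facesOfDim_polytope, CRY.coeff_F]
    push_cast
    rfl
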